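/- Let $m\ge 2$ and let $\mathcal C=(C_1,\dots,C_m)$ be an arrangement of $m$ cameras, i.e. matrices $C_i\in\mathbb C^{3\times 4}$ of rank $3$, whose centers $c_i=\ker C_i\in\mathbb P^3$ are pairwise distinct (everything is over $\mathbb C$). For any arrangement $\mathcal C'=(C_i)_{i\in I}$ of cameras, the line multiview variety $\mathcal L_{\mathcal C'}\subseteq(\mathbb P^2)^{I}$ is the Zariski closure of the set of all tuples $(\ell_i)_{i\in I}$, $\ell_i=(C_ia)\times(C_ib)$, where $a,b\in\mathbb P^3$ span a line that passes through none of the centers of $\mathcal C'$; here $\times$ is the cross product, and $\ell_i$ is the equation of the image of that line under $C_i$. For $\sigma\subseteq\{1,\dots,m\}$ write $\mathcal C_\sigma=(C_i)_{i\in\sigma}$, and let $\pi_\sigma:(\mathbb P^2)^m\to(\mathbb P^2)^\sigma$ be the projection onto the factors indexed by $\sigma$. Let $\Sigma$ be the set of all $3$-element subsets of $\{1,\dots,m\}$ together with those $4$-element subsets $\sigma$ for which the centers $c_i$, $i\in\sigma$, lie on a common line in $\mathbb P^3$. Then $$\mathcal L_{\mathcal C}=\bigcap_{\sigma\in\Sigma}\pi_\sigma^{-1}(\mathcal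 L_{\mathcal C_\sigma}),$$ where the empty intersection (which occurs for $m=2$) is $(\mathbb P^2)^m$. -/

import Mathlib

namespace LineMultiview

open Matrix
open scoped LinearAlgebra.Projectivization

/-- The projective plane over the complex numbers (here: the dual image plane, whose points are the
equations `ℓ` of the image lines `x ⬝ᵥ ℓ = 0`). -/
abbrev P2 : Type := ℙ ℂ (Fin 3 → ℂ)

/-! ### The Zariski closure in a product of projective planes -/

/-- The polynomial `f` in the variables `ℓ (i, j)` (`i : ι`, `j : Fin 3`) is multihomogeneous of
multidegree `d`: for each `i`, it is homogeneous of degree `d i` in `ℓ (i, 0), ℓ (i, 1), ℓ (i, 2)`. -/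
def IsMultihomogeneous {ι : Type} [DecidableEq ι]
    (f : MvPolynomial (ι × Fin 3) ℂ) (d : ι → ℕ) : Prop :=
  MvPolynomial.IsWeightedHomogeneous (fun p : ι × Fin 3 => (Pi.single p.1 1 : ι → ℕ)) f d

/-- The polynomial `f` vanishes at all homogeneous coordinates of the point `ℓ` of a product of
projective planes. -/
def VanishesAt {ι : Type} (f : MvPolynomial (ι × Fin 3) ℂ) (ℓ : ι → P2) : Prop :=
  ∀ (v : ι → Fin 3 → ℂ) (hv : ∀ i, v i ≠ 0), (∀ i, Projectivization.mk ℂ (v i) (hv i) = ℓ i) →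
    MvPolynomial.eval (fun p : ι × Fin 3 => v p.1 p.2) f = 0

/-- Zariski closed subsets of a product of projective planes: the common zero sets of families of
multihomogeneous polynomials. -/
def IsZariskiClosed {ι : Type} [DecidableEq ι] (Z : Set (ι → P2)) : Prop :=
  ∃ F : Set (MvPolynomial (ι × Fin 3) ℂ),
    (∀ f ∈ F, ∃ d : ι → ℕ, IsMultihomogeneous f d) ∧ Z = {ℓ | ∀ f ∈ F, VanishesAt f ℓ}

/-- The Zariski closure: the intersection of all Zariski closed sets containing `S`. -/
def zariskiClosure {ι : Type} [DecidableEq ι] (S : Set (ι → P2)) : Set (ι → P2) :=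
  ⋂₀ {Z | IsZariskiClosed Z ∧ S ⊆ Z}

/-! ### Cameras and the joint camera map -/

/-- The center of a camera: the kernel of its matrix. For a matrix of rank 3 it is a
one-dimensional subspace of `ℂ⁴`, i.e. a point of projective 3-space. -/
def center (A : Matrix (Fin 3) (Fin 4) ℂ) : Submodule ℂ (Fin 4 → ℂ) :=
  LinearMap.ker A.mulVecLin

/-- The vectors `a, b` span a line of projective 3-space (a two-dimensional subspace of `ℂ⁴`) that
passes through none of the camera centers. -/
def SpansVisibleLine {ι : Type} (C : ι → Matrix (Fin 3) (Fin 4) ℂ) (a b : Fin 4 → ℂ) : Prop :=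
  LinearIndependent ℂ ![a, b] ∧ ∀ i, Disjoint (Submodule.span ℂ {a, b}) (center (C i))

theorem cross_ne_zero {ι : Type} {C : ι → Matrix (Fin 3) (Fin 4) ℂ} {a b : Fin 4 → ℂ}
    (h : SpansVisibleLine C a b) (i : ι) :
    crossProduct (C i *ᵥ a) (C i *ᵥ b) ≠ 0 := by
  rw [crossProduct_ne_zero_iff_linearIndependent]
  have h2 := h.1.map (f := (C i).mulVecLin) (by
    simpa [center, Set.pair_comm] using h.2 i)
  have e : (C i).mulVecLin ∘ ![a, b] = ![C i *ᵥ a, C i *ᵥ b] := by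
    ext j
    fin_cases j <;> simp
  rwa [e] at h2

/-- The joint camera map: it sends the line spanned by `a` and `b`, assumed to pass through none of
the centers, to the tuple of its image lines; the image line in the `i`-th picture joins
`C i *ᵥ a` and `C i *ᵥ b`, so its equation is their cross product. -/
noncomputable def jointCameraMap {ι : Type} (C : ι → Matrix (Fin 3) (Fin 4) ℂ)
    (a b : Fin 4 → ℂ) (h : SpansVisibleLine C a b) : ι → P2 :=
  fun i => Projectivization.mk ℂ (crossProduct (C i *ᵥ a) (C i *ᵥ b)) (cross_ne_zero h i)

/-- The line multiview variety: the Zariski closure of the image of the joint camera map. -/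
def lineMultiviewVariety {ι : Type} [DecidableEq ι] (C : ι → Matrix (Fin 3) (Fin 4) ℂ) :
    Set (ι → P2) :=
  zariskiClosure {ℓ | ∃ (a b : Fin 4 → ℂ) (h : SpansVisibleLine C a b), jointCameraMap C a b h = ℓ}

/-! ### Subarrangements -/

/-- The cameras with indices in `σ` are collinear: some line of projective 3-space contains
all their centers. -/
def AreCollinear {ι : Type} (C : ι → Matrix (Fin 3) (Fin 4) ℂ) (σ : Finset ι) : Prop :=
  ∃ L : Submodule ℂ (Fin 4 → ℂ), Module.finrank ℂ L = 2 ∧ ∀ i ∈ σ, center (C i) ≤ L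

/-- All sets of three indices, and those sets of four indices that correspond to
collinear cameras. -/
def tripleAndCollinearQuadruples {ι : Type} (C : ι → Matrix (Fin 3) (Fin 4) ℂ) :
    Set (Finset ι) :=
  {σ | σ.card = 3 ∨ (σ.card = 4 ∧ AreCollinear C σ)}

/-- The subarrangement of the cameras with indices in `σ`. -/
def subarrangement {ι : Type} (C : ι → Matrix (Fin 3) (Fin 4) ℂ) (σ : Finset ι) :
    {i // i ∈ σ} → Matrix (Fin 3) (Fin 4) ℂ :=
  fun i => C i.1

/-- The projection onto the factors indexed by `σ`. -/
def proj {ι : Type} (σ : Finset ι) (ℓ : ι → P2) : {i // i ∈ σ} → P2 :=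
  fun i => ℓ i.1

end LineMultiview

namespace LineMultiview

open Matrix
open scoped LinearAlgebra.Projectivization

/-! ### Zariski closed sets and projections -/

/-! Represent the `i`-th image line by a vector `v i`. It back-projects to the plane `H i` of all
`u` with `v i ⬝ᵥ C i *ᵥ u = 0`, which contains the center `c i`. One inclusion is formal. For the
other, polynomial relations that hold on the small varieties are turned into geometry.

The triples: for the image of a visible line, all back-projected planes contain that line, so any
three of their equations are dependent (`det_plane_eq_zero`). If this holds for all triples, the
matrix of all plane equations has rank at most 2, so the planes share a line `L` spanned by some
`a`, `b` (`exists_pair_of_triples`). If `L` misses the centers, the point is simply the image of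
`L`.

Otherwise `L` must be deformed. A linear map φ from `L` to ℂ⁴ / `L` describes a first-order motion
of `L`. For a center `c i` on `L`, the plane joining it to the moving line tends to the plane
spanned by `L` and φ(`c i`), or is decided by the second-order term if φ(`c i`) = 0. It remains to
find such a motion that produces the prescribed `H i`, viewed as points of the pencil of planes
through `L`.

The quadruples: for a visible line, the plane joining it to a center on a fixed line has an equation
linear in that center, so the map from centers to planes preserves cross-ratios
(`cross_ratio_relation`). These relations suffice to find the motion (`exists_degeneration`), and
`mem_of_common_line` carries out the limit. -/

theorem IsZariskiClosed.preimage_proj {ι : Type} [DecidableEq ι] (σ : Finset ι)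
    {Z : Set ({i // i ∈ σ} → P2)} (hZ : IsZariskiClosed Z) :
    IsZariskiClosed (proj σ ⁻¹' Z) := by
  classical
  obtain ⟨F, hF, rfl⟩ := hZ
  let e : {i // i ∈ σ} × Fin 3 → ι × Fin 3 := fun p => (p.1.1, p.2)
  refine ⟨MvPolynomial.rename e '' F, ?_, ?_⟩
  · rintro _ ⟨f, hf, rfl⟩
    obtain ⟨d, hd⟩ := hF f hf
    -- The renamed polynomial does not involve the factors outside `σ`, so its degree there is 0.
    refine ⟨fun i => if h : i ∈ σ then d ⟨i, h⟩ else 0, ?_⟩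
    intro x hx
    obtain ⟨y, rfl, hy⟩ := MvPolynomial.coeff_rename_ne_zero e f x hx
    have h := hd hy
    rw [Finsupp.weight_apply] at h ⊢
    rw [Finsupp.sum_mapDomain_index (by simp) (by simp [add_smul])]
    funext i
    have hsum : ∀ i, (y.sum fun a b => b • (Pi.single (e a).1 1 : ι → ℕ)) i =
        y.sum fun a b => b • (Pi.single (e a).1 1 : ι → ℕ) i := fun i => by
      simp [Finsupp.sum, Finset.sum_apply]
    rw [hsum]
    by_cases hi : i ∈ σ
    · have h' := congrFun h ⟨i, hi⟩
      simp only [Finsupp.sum, Finset.sum_apply, Pi.smul_apply] at h'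
      simp only [hi, dif_pos, ← h', Finsupp.sum]
      refine Finset.sum_congr rfl fun p _ => ?_
      simp [e, Pi.single_apply, Subtype.ext_iff]
    · simp only [hi, dif_neg, not_false_eq_true, Finsupp.sum]
      refine Finset.sum_eq_zero fun p _ => ?_
      have : i ≠ p.1.1 := fun h => hi (h ▸ p.1.2)
      simp [e, this]
  · ext ℓ
    simp only [Set.mem_preimage, Set.mem_ofPred_eq, Set.forall_mem_image]
    refine forall₂_congr fun f _ => ⟨fun h v hv hvℓ => ?_, fun h v hv hvℓ => ?_⟩
    · rw [MvPolynomial.eval_rename]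
      exact h (fun i => v i.1) (fun i => hv i.1) (fun i => hvℓ i.1)
    -- Coordinates on the factors in `σ` are completed by arbitrary representatives, which the
    -- renamed polynomial ignores.
    · let w : ι → Fin 3 → ℂ := fun i => if hi : i ∈ σ then v ⟨i, hi⟩ else (ℓ i).rep
      have hw : ∀ i, w i ≠ 0 := fun i => by
        by_cases hi : i ∈ σ
        · simpa [w, hi] using hv ⟨i, hi⟩
        · simpa [w, hi] using (ℓ i).rep_nonzero
      have := h w hw fun i => by
        by_cases hi : i ∈ σ
        · simpa [w, hi, proj] using hvℓ ⟨i, hi⟩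
        · simp [w, hi]
      rw [MvPolynomial.eval_rename] at this
      rw [← this]
      congr 2
      funext p
      simp [w, e]

/-- A line that misses all centers misses those in `σ`, and preimages of closed sets under `proj σ`
are closed. -/
theorem lineMultiviewVariety_subset_preimage {ι : Type} [DecidableEq ι]
    (C : ι → Matrix (Fin 3) (Fin 4) ℂ) (σ : Finset ι) :
    lineMultiviewVariety C ⊆ proj σ ⁻¹' lineMultiviewVariety (subarrangement C σ) := by
  intro ℓ hℓ Z hZ
  refine hℓ (proj σ ⁻¹' Z) ⟨hZ.1.preimage_proj σ, ?_⟩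
  rintro _ ⟨a, b, h, rfl⟩
  exact hZ.2 ⟨a, b, ⟨h.1, fun i => h.2 i.1⟩, rfl⟩

/-- A multihomogeneous polynomial that vanishes on the image of the joint camera map vanishes on
the line multiview variety. -/
theorem vanishesAt_of_mem {ι : Type} [DecidableEq ι] {C : ι → Matrix (Fin 3) (Fin 4) ℂ}
    {f : MvPolynomial (ι × Fin 3) ℂ} {d : ι → ℕ} (hf : IsMultihomogeneous f d)
    (h : ∀ (a b : Fin 4 → ℂ) (s : ι → ℂ), SpansVisibleLine C a b →
      MvPolynomial.eval
        (fun p : ι × Fin 3 => (s p.1 • crossProduct (C p.1 *ᵥ a) (C p.1 *ᵥ b)) p.2) f = 0)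
    {ℓ : ι → P2} (hℓ : ℓ ∈ lineMultiviewVariety C) : VanishesAt f ℓ := by
  have := hℓ {ℓ | ∀ g ∈ ({f} : Set (MvPolynomial (ι × Fin 3) ℂ)), VanishesAt g ℓ}
    ⟨⟨{f}, by simpa using ⟨d, hf⟩, rfl⟩, ?_⟩
  · simpa using this
  · rintro _ ⟨a, b, hab, rfl⟩ g rfl v hv hvm
    have hs : ∀ i, ∃ s : ℂ, s • crossProduct (C i *ᵥ a) (C i *ᵥ b) = v i := fun i => by
      have := hvm i
      rwa [jointCameraMap, Projectivization.mk_eq_mk_iff'] at this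
    choose s hs using hs
    have := h a b s hab
    simpa only [hs] using this

/-- Points that are limits of rescaled images of visible lines lie in the line multiview variety. -/
theorem mem_of_curve {ι : Type} [DecidableEq ι] [Finite ι] [Nonempty ι]
    {C : ι → Matrix (Fin 3) (Fin 4) ℂ}
    (a b : ℂ → Fin 4 → ℂ) (w : ℂ → ι → Fin 3 → ℂ) (hw : Continuous w) (hw0 : ∀ i, w 0 i ≠ 0)
    (h : ∀ t, t ≠ 0 → ∀ i, ∃ s : ℂ, s • w t i = crossProduct (C i *ᵥ a t) (C i *ᵥ b t) ∧ s ≠ 0) :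
    (fun i => Projectivization.mk ℂ (w 0 i) (hw0 i)) ∈ lineMultiviewVariety C := by
  have hvis : ∀ a b : Fin 4 → ℂ, (∀ i, crossProduct (C i *ᵥ a) (C i *ᵥ b) ≠ 0) →
      SpansVisibleLine C a b := by
    intro a b hab
    simp only [crossProduct_ne_zero_iff_linearIndependent,
      LinearIndependent.pair_iff] at hab
    refine ⟨?_, fun i => ?_⟩
    · rw [LinearIndependent.pair_iff]
      intro s t hst
      refine hab (Classical.arbitrary ι) s t ?_
      rw [← mulVec_smul, ← mulVec_smul, ← mulVec_add, hst, mulVec_zero]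
    · rw [Submodule.disjoint_def]
      intro x hx hx'
      obtain ⟨s, t, rfl⟩ := Submodule.mem_span_pair.1 hx
      have h0 : C i *ᵥ (s • a + t • b) = 0 := hx'
      rw [mulVec_add, mulVec_smul, mulVec_smul] at h0
      obtain ⟨rfl, rfl⟩ := hab i s t h0
      simp
  rintro Z ⟨⟨F, -, rfl⟩, hZ⟩ f hf v hv hvm
  have hr : ∀ i, ∃ r : ℂ, r • w 0 i = v i := fun i =>
    (Projectivization.mk_eq_mk_iff' ℂ _ _ (hv i) (hw0 i)).1 (hvm i)
  choose r hr using hr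
  have hr0 : ∀ i, r i ≠ 0 := fun i hi => hv i (by rw [← hr, hi, zero_smul])
  -- Every defining polynomial vanishes along the rescaled curve for small `t ≠ 0`, hence by
  -- continuity also at `t = 0`. The constants `r i` make the curve end at the chosen coordinates
  -- `v`.
  let g : ℂ → ℂ := fun t => MvPolynomial.eval (fun p : ι × Fin 3 => (r p.1 • w t p.1) p.2) f
  have hg : Continuous g := by
    refine (MvPolynomial.continuous_eval f).comp (continuous_pi fun p => ?_)
    exact continuous_const.mul ((continuous_apply p.2).comp ((continuous_apply p.1).comp hw))
  have hne : ∀ᶠ t in nhdsWithin (0 : ℂ) {0}ᶜ, ∀ i, w t i ≠ 0 := by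
    refine Filter.Eventually.filter_mono nhdsWithin_le_nhds (Filter.eventually_all.2 fun i => ?_)
    exact ((continuous_apply i).comp hw).continuousAt.eventually_ne (hw0 i)
  have hgz : ∀ᶠ t in nhdsWithin (0 : ℂ) {0}ᶜ, g t = 0 := by
    filter_upwards [hne, self_mem_nhdsWithin] with t ht ht0
    choose s hs hs0 using h t ht0
    have hcr : ∀ i, crossProduct (C i *ᵥ a t) (C i *ᵥ b t) ≠ 0 := fun i => by
      rw [← hs]
      exact smul_ne_zero (hs0 i) (ht i)
    have hmem : jointCameraMap C (a t) (b t) (hvis _ _ hcr) ∈ {ℓ | ∀ f ∈ F, VanishesAt f ℓ} :=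
      hZ ⟨a t, b t, hvis _ _ hcr, rfl⟩
    refine hmem f hf (fun i => r i • w t i) (fun i => smul_ne_zero (hr0 i) (ht i)) fun i => ?_
    rw [jointCameraMap, Projectivization.mk_eq_mk_iff']
    refine ⟨r i * (s i)⁻¹, ?_⟩
    rw [← hs, smul_smul, mul_assoc, inv_mul_cancel₀ (hs0 i), mul_one]
  have hlim : Filter.Tendsto g (nhdsWithin (0 : ℂ) {0}ᶜ) (nhds (g 0)) :=
    hg.continuousAt.tendsto.mono_left nhdsWithin_le_nhds
  have h0 := tendsto_nhds_unique hlim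
    (tendsto_const_nhds.congr' (hgz.mono fun _ h => h.symm))
  simpa only [g, hr] using h0

/-! ### Configurations of points on the projective line -/

theorem exists_linearForm_ne_zero {ι : Type} [Finite ι] (x y : ι → ℂ)
    (h : ∀ i, x i ≠ 0 ∨ y i ≠ 0) : ∃ p q : ℂ, ∀ i, p * x i + q * y i ≠ 0 := by
  -- Only finitely many slopes are bad. Where `y i = 0` the quotient is the junk value 0, which
  -- merely excludes one more `z`.
  obtain ⟨z, hz⟩ := (Set.finite_range fun i => -(x i) / y i).infinite_compl.nonempty
  refine ⟨1, z, fun i hi => ?_⟩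
  by_cases hy : y i = 0
  · have := (h i).resolve_right (by simpa using hy)
    simp_all
  · refine hz ⟨i, ?_⟩
    field_simp
    linear_combination -hi

/-- If four-point subconfigurations of `h` satisfy the cross-ratio relations of the pairwise
distinct points `(x i : y i)` of the projective line, then `h` is a limit of images of this
configuration under projectivities. -/
theorem exists_degeneration {ι : Type} [Finite ι] (x y α β : ι → ℂ)
    (hc : ∀ i j, i ≠ j → x i * y j - x j * y i ≠ 0)
    (hc0 : ∀ i, x i ≠ 0 ∨ y i ≠ 0)
    (hh : ∀ i, α i ≠ 0 ∨ β i ≠ 0)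
    (hrel : ∀ i j k l, i ≠ j → i ≠ k → i ≠ l → j ≠ k → j ≠ l → k ≠ l →
      (α i * β j - α j * β i) * (α k * β l - α l * β k) *
        ((x i * y k - x k * y i) * (x j * y l - x l * y j)) =
      (α i * β k - α k * β i) * (α j * β l - α l * β j) *
        ((x i * y j - x j * y i) * (x k * y l - x l * y k))) :
    ∃ p q : Fin 2 → ℂ × ℂ, ∀ i,
      (x i • p 0 + y i • q 0 ≠ 0 ∧
        (x i • p 0 + y i • q 0).1 * β i = (x i • p 0 + y i • q 0).2 * α i) ∨
      (x i • p 0 + y i • q 0 = 0 ∧ x i • p 1 + y i • q 1 ≠ 0 ∧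
        (x i • p 1 + y i • q 1).1 * β i = (x i • p 1 + y i • q 1).2 * α i) := by
  by_cases h0 : ∀ i j, α i * β j - α j * β i = 0
  · -- all points coincide
    obtain ⟨p, q, hpq⟩ := exists_linearForm_ne_zero x y hc0
    rcases isEmpty_or_nonempty ι with hι | ⟨⟨i₀⟩⟩
    · exact ⟨0, 0, fun i => hι.elim i⟩
    refine ⟨fun _ => (p * α i₀, p * β i₀), fun _ => (q * α i₀, q * β i₀), fun i => Or.inl ⟨?_, ?_⟩⟩
    · simp only [ne_eq, Prod.ext_iff, Prod.fst_add, Prod.snd_add, Prod.smul_mk, smul_eq_mul,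
        Prod.fst_zero, Prod.snd_zero, not_and_or]
      refine (hh i₀).imp (fun h h' => ?_) (fun h h' => ?_)
      · exact mul_ne_zero (hpq i) h (by linear_combination h')
      · exact mul_ne_zero (hpq i) h (by linear_combination h')
    · simp only [Prod.fst_add, Prod.snd_add, Prod.smul_mk, smul_eq_mul]
      linear_combination (p * x i + q * y i) * h0 i₀ i
  push Not at h0
  obtain ⟨i, j, hij⟩ := h0
  have hij' : i ≠ j := by
    rintro rfl
    exact hij (by ring)
  by_cases h3 : ∃ k, α i * β k - α k * β i ≠ 0 ∧ α j * β k - α k * β j ≠ 0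
  · -- three distinct points determine a projectivity
    obtain ⟨k, hik, hjk⟩ := h3
    have hik' : i ≠ k := by
      rintro rfl
      exact hik (by ring)
    have hjk' : j ≠ k := by
      rintro rfl
      exact hjk (by ring)
    -- The map sends `(x, y)` to `μ (x y_j - y x_j) (α_i, β_i) + ν (x y_i - y x_i) (α_j, β_j)`. For
    -- any weights it matches the points `i` and `j`; these weights make it match `k` too, and the
    -- cross-ratio relation then gives every other `l`.
    set μ := (α j * β k - α k * β j) * (x i * y k - x k * y i) with hμ
    set ν := (α i * β k - α k * β i) * (x k * y j - x j * y k) with hν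
    have hμ0 : μ ≠ 0 := mul_ne_zero hjk (hc _ _ hik')
    have hν0 : ν ≠ 0 := mul_ne_zero hik (hc _ _ hjk'.symm)
    refine ⟨fun _ => (μ * y j * α i + ν * y i * α j, μ * y j * β i + ν * y i * β j),
      fun _ => (-(μ * x j * α i + ν * x i * α j), -(μ * x j * β i + ν * x i * β j)),
      fun l => Or.inl ⟨fun h => ?_, ?_⟩⟩
    · simp only [Prod.ext_iff, Prod.fst_add, Prod.snd_add, Prod.smul_mk, smul_eq_mul,
        Prod.fst_zero, Prod.snd_zero] at h
      obtain ⟨h1, h2⟩ := h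
      have e1 : (x l * y j - x j * y l) * μ * (α i * β j - α j * β i) = 0 := by
        linear_combination β j * h1 - α j * h2
      have e2 : (x l * y i - x i * y l) * ν * (α i * β j - α j * β i) = 0 := by
        linear_combination α i * h2 - β i * h1
      simp only [mul_eq_zero, hμ0, hν0, hij, or_false] at e1 e2
      by_cases hl : l = j
      · exact hc _ _ (by rintro rfl; exact hij' hl) e2
      · exact hc _ _ hl e1
    · simp only [Prod.fst_add, Prod.snd_add, Prod.smul_mk, smul_eq_mul]
      by_cases hli : l = i
      · subst hli
        ring
      by_cases hlj : l = j
      · subst hlj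
        ring
      by_cases hlk : l = k
      · subst hlk
        rw [hμ, hν]
        ring
      have := hrel i l k j (Ne.symm hli) hik' hij' hlk hlj hjk'.symm
      rw [hμ, hν]
      linear_combination -this
  · -- exactly two distinct points, one of which is simple
    push Not at h3
    have key : ∀ i j, i ≠ j → α i * β j - α j * β i ≠ 0 →
        (∀ k, k ≠ i → α j * β k - α k * β j = 0) →
        ∃ p q : Fin 2 → ℂ × ℂ, ∀ i,
          (x i • p 0 + y i • q 0 ≠ 0 ∧
            (x i • p 0 + y i • q 0).1 * β i = (x i • p 0 + y i • q 0).2 * α i) ∨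
          (x i • p 0 + y i • q 0 = 0 ∧ x i • p 1 + y i • q 1 ≠ 0 ∧
            (x i • p 1 + y i • q 1).1 * β i = (x i • p 1 + y i • q 1).2 * α i) := by
      intro i j hij' hij hk
      obtain ⟨p, q, hpq⟩ := exists_linearForm_ne_zero x y hc0
      -- The leading map is `(x_i y - y_i x) (α_j, β_j)`: it kills exactly the simple point `i` and
      -- sends all others to the common value. The next-order map is a nowhere vanishing form times
      -- `(α_i, β_i)`, which gives `i` its value.
      refine ⟨![(-(y i * α j), -(y i * β j)), (p * α i, p * β i)],
        ![(x i * α j, x i * β j), (q * α i, q * β i)], fun k => ?_⟩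
      by_cases hki : k = i
      · subst hki
        refine Or.inr ⟨?_, ?_, ?_⟩
        · ext <;> simp <;> ring
        · simp only [ne_eq, Prod.ext_iff, Prod.fst_add, Prod.snd_add, Prod.smul_mk, smul_eq_mul,
            Prod.fst_zero, Prod.snd_zero, not_and_or, Matrix.cons_val_one, Matrix.cons_val_zero]
          refine (hh k).imp (fun h h' => ?_) (fun h h' => ?_)
          · exact mul_ne_zero (hpq k) h (by linear_combination h')
          · exact mul_ne_zero (hpq k) h (by linear_combination h')
        · simp
          ring
      · refine Or.inl ⟨?_, ?_⟩
        · simp only [ne_eq, Prod.ext_iff, Prod.fst_add, Prod.snd_add, Prod.smul_mk, smul_eq_mul,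
            Prod.fst_zero, Prod.snd_zero, not_and_or, Matrix.cons_val_zero]
          have hc' := hc i k (Ne.symm hki)
          refine (hh j).imp (fun h h' => ?_) (fun h h' => ?_)
          · exact mul_ne_zero hc' h (by linear_combination h')
          · exact mul_ne_zero hc' h (by linear_combination h')
        · simp
          linear_combination (x i * y k - x k * y i) * hk k hki
    by_cases hi : ∀ k, k ≠ i → α j * β k - α k * β j = 0
    · exact key i j hij' hij hi
    · push Not at hi
      obtain ⟨k, hki, hjk⟩ := hi
      have hik : α i * β k - α k * β i = 0 := by
        by_contra h
        exact hjk (h3 k h)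
      have hkj : k ≠ j := by
        rintro rfl
        exact hjk (by ring)
      refine key j i hij'.symm (by contrapose! hij; linear_combination -hij) fun l hlj => ?_
      by_contra hil
      have hjl := h3 l hil
      have hli : l ≠ i := by
        rintro rfl
        exact hil (by ring)
      have hlk : l ≠ k := by
        rintro rfl
        exact hil hik
      -- If neither value were simple, `k` would share the value of `i` and `l` that of `j`. For
      -- such a 2 + 2 split one side of the relation vanishes and the other does not.
      have := hrel i k j l hki.symm hij' hli.symm hkj hlk.symm hlj.symm
      rw [hik, hjl] at this
      have hkl : α k * β l - α l * β k ≠ 0 := by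
        intro hkl
        refine (hh k).elim (fun h => h ?_) (fun h => h ?_)
        · exact (mul_eq_zero.1 (by linear_combination α l * hik + α i * hkl :
            (α i * β l - α l * β i) * α k = 0)).resolve_left hil
        · exact (mul_eq_zero.1 (by linear_combination β l * hik + β i * hkl :
            (α i * β l - α l * β i) * β k = 0)).resolve_left hil
      have h4 := mul_ne_zero (mul_ne_zero hij hkl)
        (mul_ne_zero (hc _ _ hki.symm) (hc _ _ hlj.symm))
      exact h4 (by linear_combination -this)

/-! ### Back-projected planes -/

/-- The equation of the back-projected plane, as a linear form in the point `u` whose coefficients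
are polynomials in the image lines. -/
noncomputable def planeForm {ι : Type} (C : ι → Matrix (Fin 3) (Fin 4) ℂ) (i : ι)
    (u : Fin 4 → ℂ) : MvPolynomial (ι × Fin 3) ℂ :=
  ∑ j, MvPolynomial.C ((C i *ᵥ u) j) * MvPolynomial.X (i, j)

theorem eval_planeForm {ι : Type} (C : ι → Matrix (Fin 3) (Fin 4) ℂ) (i : ι) (u : Fin 4 → ℂ)
    (v : ι → Fin 3 → ℂ) :
    MvPolynomial.eval (fun p : ι × Fin 3 => v p.1 p.2) (planeForm C i u) = v i ⬝ᵥ C i *ᵥ u := by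
  simp [planeForm, dotProduct, mul_comm]

theorem isMultihomogeneous_planeForm {ι : Type} [DecidableEq ι]
    (C : ι → Matrix (Fin 3) (Fin 4) ℂ) (i : ι) (u : Fin 4 → ℂ) :
    IsMultihomogeneous (planeForm C i u) (Pi.single i 1) := by
  refine MvPolynomial.IsWeightedHomogeneous.sum _ _ _ fun j _ => ?_
  have := (MvPolynomial.isWeightedHomogeneous_C
    (fun p : ι × Fin 3 => (Pi.single p.1 1 : ι → ℕ)) ((C i *ᵥ u) j)).mul
    (MvPolynomial.isWeightedHomogeneous_X ℂ
      (fun p : ι × Fin 3 => (Pi.single p.1 1 : ι → ℕ)) (i, j))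
  rwa [zero_add] at this

/-- Any three back-projected planes of a point of the line multiview variety have linearly
dependent equations. -/
theorem det_plane_eq_zero {ι : Type} [DecidableEq ι] {C : ι → Matrix (Fin 3) (Fin 4) ℂ}
    (k : Fin 3 → ι) (u : Fin 3 → Fin 4 → ℂ) (v : ι → Fin 3 → ℂ) (hv : ∀ i, v i ≠ 0)
    (hℓ : (fun i => Projectivization.mk ℂ (v i) (hv i)) ∈ lineMultiviewVariety C) :
    (Matrix.of fun r s => v (k r) ⬝ᵥ C (k r) *ᵥ u s).det = 0 := by
  have hf : IsMultihomogeneous (Matrix.of fun r s => planeForm C (k r) (u s)).det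
      (∑ r, Pi.single (k r) 1) := by
    rw [det_apply]
    refine MvPolynomial.IsWeightedHomogeneous.sum _ _ _ fun g _ => ?_
    have := MvPolynomial.IsWeightedHomogeneous.prod Finset.univ
      (fun s => planeForm C (k (g s)) (u s)) _
      (fun s _ => isMultihomogeneous_planeForm C (k (g s)) (u s))
    rw [Equiv.sum_comp g fun r => (Pi.single (k r) 1 : ι → ℕ)] at this
    rw [Units.smul_def]
    exact (MvPolynomial.weightedHomogeneousSubmodule ℂ
      (fun p : ι × Fin 3 => (Pi.single p.1 1 : ι → ℕ)) _).smul_of_tower_mem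
      ((Equiv.Perm.sign g : ℤˣ) : ℤ) this
  have heval : ∀ w : ι → Fin 3 → ℂ, MvPolynomial.eval (fun p : ι × Fin 3 => w p.1 p.2)
      (Matrix.of fun r s => planeForm C (k r) (u s)).det =
      (Matrix.of fun r s => w (k r) ⬝ᵥ C (k r) *ᵥ u s).det := fun w => by
    rw [RingHom.map_det]
    congr 1
    ext r s
    simp [eval_planeForm]
  rw [← heval]
  refine vanishesAt_of_mem hf (fun a b s hab => ?_) hℓ v hv fun _ => rfl
  rw [heval (fun i => s i • crossProduct (C i *ᵥ a) (C i *ᵥ b))]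
  -- The rows of `N` are the plane equations of a visible line. All kill `a` and `b`, so `N` has
  -- rank at most 2 and `N` times any test matrix is singular.
  set N : Matrix (Fin 3) (Fin 4) ℂ := Matrix.of fun r =>
    (s (k r) • crossProduct (C (k r) *ᵥ a) (C (k r) *ᵥ b)) ᵥ* C (k r) with hN
  have hNU : (Matrix.of fun r t => (s (k r) • crossProduct (C (k r) *ᵥ a) (C (k r) *ᵥ b)) ⬝ᵥ
      C (k r) *ᵥ u t) = N * (Matrix.of u)ᵀ := by
    ext r t
    rw [Matrix.mul_apply', of_apply, dotProduct_mulVec]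
    rfl
  have hNz : ∀ x, (∀ i, crossProduct (C i *ᵥ a) (C i *ᵥ b) ⬝ᵥ C i *ᵥ x = 0) → N *ᵥ x = 0 := by
    intro x hx
    ext r
    have : (N *ᵥ x) r = (s (k r) • crossProduct (C (k r) *ᵥ a) (C (k r) *ᵥ b)) ⬝ᵥ C (k r) *ᵥ x := by
      rw [dotProduct_mulVec]; rfl
    rw [this, smul_dotProduct, hx, smul_zero, Pi.zero_apply]
  have hNa : N *ᵥ a = 0 := hNz a fun i => by rw [dotProduct_comm, dot_self_cross]
  have hNb : N *ᵥ b = 0 := hNz b fun i => by rw [dotProduct_comm, dot_cross_self]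
  have hker : 2 ≤ Module.finrank ℂ (LinearMap.ker N.mulVecLin) := by
    have h2 : Module.finrank ℂ (Submodule.span ℂ (Set.range ![a, b])) = 2 :=
      finrank_span_eq_card hab.1
    rw [← h2]
    refine Submodule.finrank_mono (Submodule.span_le.2 ?_)
    rintro _ ⟨j, rfl⟩
    fin_cases j
    · exact hNa
    · exact hNb
  have hrk : N.rank ≤ 2 := by
    have := N.mulVecLin.finrank_range_add_finrank_ker
    rw [Module.finrank_fin_fun] at this
    rw [Matrix.rank]
    omega
  rw [hNU]
  by_contra hdet
  have h3 := Matrix.rank_of_isUnit _ ((Matrix.isUnit_iff_isUnit_det _).2 (isUnit_iff_ne_zero.2 hdet))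
  have := Matrix.rank_mul_le_left N (Matrix.of u)ᵀ
  rw [h3, Fintype.card_fin] at this
  omega

/-! ### Cross-ratios of planes through collinear centers -/

/-- The triple product of the images of three points, in terms of the center of the camera. -/
theorem exists_triple_product (A : Matrix (Fin 3) (Fin 4) ℂ) {c : Fin 4 → ℂ}
    (hc : center A = Submodule.span ℂ {c}) :
    ∃ κ : ℂ, ∀ a b u : Fin 4 → ℂ, crossProduct (A *ᵥ a) (A *ᵥ b) ⬝ᵥ A *ᵥ u =
      κ * ∑ j, c j * ((-1) ^ (j : ℕ) * ((Matrix.of ![a, b, u]).submatrix id j.succAbove).det) := by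
  -- The signed maximal minors of `A` form a kernel vector, hence a multiple `κ` of `c`. The formula
  -- is then Cauchy–Binet for `A` times the matrix with columns `a`, `b`, `u`.
  set n : Fin 4 → ℂ := fun j => (-1) ^ (j : ℕ) * (A.submatrix id j.succAbove).det with hn
  have hmem : n ∈ center A := by
    change A *ᵥ n = 0
    ext i
    fin_cases i <;>
    · simp [hn, mulVec, dotProduct, Fin.sum_univ_four, det_fin_three, Fin.succAbove]
      ring
  rw [hc, Submodule.mem_span_singleton] at hmem
  obtain ⟨κ, hκ⟩ := hmem
  refine ⟨κ, fun a b u => ?_⟩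
  have h : crossProduct (A *ᵥ a) (A *ᵥ b) ⬝ᵥ A *ᵥ u =
      ∑ j, n j * ((-1) ^ (j : ℕ) * ((Matrix.of ![a, b, u]).submatrix id j.succAbove).det) := by
    simp [hn, mulVec, dotProduct, cross_apply, Fin.sum_univ_succ, det_fin_three, Fin.succAbove]
    ring
  rw [h, ← hκ, Finset.mul_sum]
  refine Finset.sum_congr rfl fun j _ => ?_
  rw [Pi.smul_apply, smul_eq_mul, mul_assoc]

/-- The equations of the planes that four collinear cameras back-project satisfy the cross-ratio
relations of the centers. -/
theorem cross_ratio_relation {ι : Type} [DecidableEq ι] {C : ι → Matrix (Fin 3) (Fin 4) ℂ}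
    (k : Fin 4 → ι) (p q : Fin 4 → ℂ) (x y : Fin 4 → ℂ)
    (hc : ∀ r, center (C (k r)) = Submodule.span ℂ {x r • p + y r • q})
    (u u' : Fin 4 → ℂ) (v : ι → Fin 3 → ℂ) (hv : ∀ i, v i ≠ 0)
    (hℓ : (fun i => Projectivization.mk ℂ (v i) (hv i)) ∈ lineMultiviewVariety C)
    (α β : Fin 4 → ℂ) (hα : ∀ r, α r = v (k r) ⬝ᵥ C (k r) *ᵥ u)
    (hβ : ∀ r, β r = v (k r) ⬝ᵥ C (k r) *ᵥ u') :
    (α 0 * β 1 - α 1 * β 0) * (α 2 * β 3 - α 3 * β 2) *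
        ((x 0 * y 2 - x 2 * y 0) * (x 1 * y 3 - x 3 * y 1)) =
      (α 0 * β 2 - α 2 * β 0) * (α 1 * β 3 - α 3 * β 1) *
        ((x 0 * y 1 - x 1 * y 0) * (x 2 * y 3 - x 3 * y 2)) := by
  let D : Fin 4 → Fin 4 → MvPolynomial (ι × Fin 3) ℂ := fun r s =>
    planeForm C (k r) u * planeForm C (k s) u' - planeForm C (k s) u * planeForm C (k r) u'
  have hD : ∀ r s, IsMultihomogeneous (D r s) (Pi.single (k r) 1 + Pi.single (k s) 1) :=
    fun r s => by
      refine (MvPolynomial.weightedHomogeneousSubmodule ℂ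
        (fun p : ι × Fin 3 => (Pi.single p.1 1 : ι → ℕ)) _).sub_mem
        ((isMultihomogeneous_planeForm C _ _).mul (isMultihomogeneous_planeForm C _ _)) ?_
      rw [add_comm]
      exact (isMultihomogeneous_planeForm C _ _).mul (isMultihomogeneous_planeForm C _ _)
  let f : MvPolynomial (ι × Fin 3) ℂ :=
    ((x 0 * y 2 - x 2 * y 0) * (x 1 * y 3 - x 3 * y 1)) • (D 0 1 * D 2 3) -
      ((x 0 * y 1 - x 1 * y 0) * (x 2 * y 3 - x 3 * y 2)) • (D 0 2 * D 1 3)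
  have hf : IsMultihomogeneous f ((Pi.single (k 0) 1 + Pi.single (k 1) 1) +
      (Pi.single (k 2) 1 + Pi.single (k 3) 1)) := by
    refine Submodule.sub_mem (MvPolynomial.weightedHomogeneousSubmodule ℂ
        (fun p : ι × Fin 3 => (Pi.single p.1 1 : ι → ℕ)) _)
      (Submodule.smul_mem _ _ ((hD 0 1).mul (hD 2 3)))
      (Submodule.smul_mem _ _ ?_)
    rw [add_add_add_comm]
    exact (hD 0 2).mul (hD 1 3)
  have heval := vanishesAt_of_mem hf (fun a b s hab => ?_) hℓ v hv fun _ => rfl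
  · simp only [f, D, map_sub, MvPolynomial.smul_eval, map_mul, eval_planeForm, ← hα, ← hβ] at heval
    linear_combination heval
  · choose κ hκ using fun r => exists_triple_product (C (k r)) (hc r)
    -- Up to sign `P c u` is the determinant of `a`, `b`, `u`, `c`. Linearity in `c` makes each
    -- plane equation the image of `(x r, y r)` under one linear map, up to a scalar, so the
    -- relation becomes an identity.
    let P : (Fin 4 → ℂ) → (Fin 4 → ℂ) → ℂ := fun c u =>
      ∑ j, c j * ((-1) ^ (j : ℕ) * ((Matrix.of ![a, b, u]).submatrix id j.succAbove).det)
    have hP : ∀ r z, (s (k r) • crossProduct (C (k r) *ᵥ a) (C (k r) *ᵥ b)) ⬝ᵥ C (k r) *ᵥ z =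
        s (k r) * κ r * (x r * P p z + y r * P q z) := fun r z => by
      rw [smul_dotProduct, hκ, smul_eq_mul, mul_assoc]
      simp only [P, Finset.mul_sum, ← Finset.sum_add_distrib]
      refine Finset.sum_congr rfl fun j _ => ?_
      simp only [Pi.add_apply, Pi.smul_apply, smul_eq_mul]
      ring
    have he := fun r z => eval_planeForm C (k r) z
      (fun i => s i • crossProduct (C i *ᵥ a) (C i *ᵥ b))
    simp only [hP] at he
    simp only [f, D, map_sub, MvPolynomial.smul_eval, map_mul, he]
    ring

/-- A plane through the center of a camera is determined by its image, a line through the images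
of two points of the plane. -/
theorem mk_cross_eq {A : Matrix (Fin 3) (Fin 4) ℂ} {v : Fin 3 → ℂ} (hv : v ≠ 0)
    {a b : Fin 4 → ℂ} (ha : v ⬝ᵥ A *ᵥ a = 0) (hb : v ⬝ᵥ A *ᵥ b = 0)
    (h : crossProduct (A *ᵥ a) (A *ᵥ b) ≠ 0) :
    Projectivization.mk ℂ _ h = Projectivization.mk ℂ v hv := by
  rw [Projectivization.mk_eq_mk_iff_crossProduct_eq_zero]
  rw [cross_cross_eq_smul_sub_smul]
  rw [dotProduct_comm _ v, dotProduct_comm _ v, ha, hb]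
  simp

theorem cross_ne_zero_of_center {A : Matrix (Fin 3) (Fin 4) ℂ} {c : Fin 4 → ℂ}
    (hc : center A = Submodule.span ℂ {c}) {a b : Fin 4 → ℂ}
    (h : ∀ s t r : ℂ, s • a + t • b = r • c → s = 0 ∧ t = 0) :
    crossProduct (A *ᵥ a) (A *ᵥ b) ≠ 0 := by
  rw [crossProduct_ne_zero_iff_linearIndependent, LinearIndependent.pair_iff]
  intro s t hst
  rw [← mulVec_smul, ← mulVec_smul, ← mulVec_add] at hst
  have hmem : s • a + t • b ∈ center A := hst
  rw [hc, Submodule.mem_span_singleton] at hmem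
  obtain ⟨r, hr⟩ := hmem
  exact h s t r hr.symm

theorem exists_center_eq_span {A : Matrix (Fin 3) (Fin 4) ℂ} (hA : A.rank = 3) :
    ∃ c, c ≠ 0 ∧ center A = Submodule.span ℂ {c} := by
  have h := A.mulVecLin.finrank_range_add_finrank_ker
  rw [Module.finrank_fin_fun] at h
  rw [Matrix.rank] at hA
  have h1 : Module.finrank ℂ (center A) = 1 := by
    rw [center]
    omega
  obtain ⟨c, hc0, hc⟩ := finrank_eq_one_iff'.1 h1
  refine ⟨c, by simpa using hc0, le_antisymm (fun w hw => ?_) ?_⟩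
  · obtain ⟨r, hr⟩ := hc ⟨w, hw⟩
    exact Submodule.mem_span_singleton.2 ⟨r, congrArg Subtype.val hr⟩
  · rw [Submodule.span_singleton_le_iff_mem]
    exact c.2

/-! ### Points with a common line in the back-projected planes -/

/-- Each camera may choose its own rescaled limit curve, so that centers on and off the common line
can be treated separately. -/
theorem mem_of_curves {ι : Type} [DecidableEq ι] [Finite ι] [Nonempty ι]
    {C : ι → Matrix (Fin 3) (Fin 4) ℂ} {ℓ : ι → P2} (a b : ℂ → Fin 4 → ℂ)
    (h : ∀ i, ∃ w : ℂ → Fin 3 → ℂ, Continuous w ∧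
      (∃ h0 : w 0 ≠ 0, Projectivization.mk ℂ (w 0) h0 = ℓ i) ∧
      ∀ t, t ≠ 0 → ∃ s : ℂ, s • w t = crossProduct (C i *ᵥ a t) (C i *ᵥ b t) ∧ s ≠ 0) :
    ℓ ∈ lineMultiviewVariety C := by
  choose w hw h01 hs using h
  choose h0 h1 using h01
  have := mem_of_curve (C := C) a b (fun t i => w i t) (continuous_pi hw) h0
    fun t ht i => hs i t ht
  simpa only [h1] using this

theorem continuous_cross {A : Matrix (Fin 3) (Fin 4) ℂ} {d g : ℂ → Fin 4 → ℂ}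
    (hd : Continuous d) (hg : Continuous g) :
    Continuous fun t => crossProduct (A *ᵥ d t) (A *ᵥ g t) := by
  have h1 : Continuous fun t => A *ᵥ d t := Continuous.matrix_mulVec continuous_const hd
  have h2 : Continuous fun t => A *ᵥ g t := Continuous.matrix_mulVec continuous_const hg
  simp only [cross_apply]
  refine continuous_pi fun j => ?_
  fin_cases j <;> simp <;> fun_prop

theorem cross_combination (A : Matrix (Fin 3) (Fin 4) ℂ) (a b : Fin 4 → ℂ) (x y x' y' : ℂ) :
    crossProduct (A *ᵥ (x • a + y • b)) (A *ᵥ (x' • a + y' • b)) =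
      (x * y' - y * x') • crossProduct (A *ᵥ a) (A *ᵥ b) := by
  simp only [mulVec_add, mulVec_smul, map_add, map_smul, LinearMap.add_apply, LinearMap.smul_apply,
    cross_self]
  rw [← cross_anticomm (A *ᵥ a) (A *ᵥ b)]
  module

theorem injective_vec_four {α : Type} {i j k l : α} (hij : i ≠ j) (hik : i ≠ k) (hil : i ≠ l)
    (hjk : j ≠ k) (hjl : j ≠ l) (hkl : k ≠ l) : Function.Injective ![i, j, k, l] := by
  intro r s hrs
  fin_cases r <;> fin_cases s <;> simp_all

/-- If the back-projected planes share a line, and if the cross-ratio relations hold for the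
cameras with centers on this line, then the point lies in the line multiview variety. -/
theorem mem_of_common_line {ι : Type} [DecidableEq ι] [Finite ι] [Nonempty ι]
    {C : ι → Matrix (Fin 3) (Fin 4) ℂ} (c : ι → Fin 4 → ℂ) (hc0 : ∀ i, c i ≠ 0)
    (hc : ∀ i, center (C i) = Submodule.span ℂ {c i})
    (hne : ∀ i j, i ≠ j → ∀ r : ℂ, r • c i ≠ c j)
    (v : ι → Fin 3 → ℂ) (hv : ∀ i, v i ≠ 0)
    {a b e f : Fin 4 → ℂ} (hab : LinearIndependent ℂ ![a, b])
    (hva : ∀ i, v i ⬝ᵥ C i *ᵥ a = 0) (hvb : ∀ i, v i ⬝ᵥ C i *ᵥ b = 0)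
    (hef : ∀ s t : ℂ, s • e + t • f ∈ Submodule.span ℂ {a, b} → s = 0 ∧ t = 0)
    (hvef : ∀ i, v i ⬝ᵥ C i *ᵥ e ≠ 0 ∨ v i ⬝ᵥ C i *ᵥ f ≠ 0)
    (hrel : ∀ (k : Fin 4 → ι), Function.Injective k → ∀ x y : Fin 4 → ℂ,
      (∀ r, c (k r) = x r • a + y r • b) →
      ∀ α β : Fin 4 → ℂ, (∀ r, α r = v (k r) ⬝ᵥ C (k r) *ᵥ f) →
      (∀ r, β r = v (k r) ⬝ᵥ C (k r) *ᵥ e) →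
      (α 0 * β 1 - α 1 * β 0) * (α 2 * β 3 - α 3 * β 2) *
        ((x 0 * y 2 - x 2 * y 0) * (x 1 * y 3 - x 3 * y 1)) =
      (α 0 * β 2 - α 2 * β 0) * (α 1 * β 3 - α 3 * β 1) *
        ((x 0 * y 1 - x 1 * y 0) * (x 2 * y 3 - x 3 * y 2))) :
    (fun i => Projectivization.mk ℂ (v i) (hv i)) ∈ lineMultiviewVariety C := by
  classical
  have hab' := LinearIndependent.pair_iff.1 hab
  have hS : ∀ i : {i // c i ∈ Submodule.span ℂ {a, b}}, ∃ x y : ℂ, x • a + y • b = c i :=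
    fun i => Submodule.mem_span_pair.1 i.2
  choose x y hxy using hS
  -- The vector `s • e + t • f` lies in the `i`-th plane exactly when `(s, t)` is proportional to
  -- `(-(v i ⬝ᵥ C i *ᵥ f), v i ⬝ᵥ C i *ᵥ e)`. These are the coordinates of the plane in the pencil
  -- through the line.
  obtain ⟨p, q, hpq⟩ := exists_degeneration x y (fun i => -(v i ⬝ᵥ C i *ᵥ f))
    (fun i => v i ⬝ᵥ C i *ᵥ e)
    (fun i j hij h0 => by
      by_cases hx : x i = 0
      · have hy : y i ≠ 0 := fun hy => hc0 i (by rw [← hxy, hx, hy]; simp)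
        have hxj : x j = 0 := by simpa [hx, hy] using h0
        refine hne i j (fun h => hij (Subtype.ext h)) (y j / y i) ?_
        rw [← hxy, ← hxy, hx, hxj, zero_smul, zero_add, zero_add, smul_smul,
          div_mul_cancel₀ _ hy]
      · refine hne i j (fun h => hij (Subtype.ext h)) (x j / x i) ?_
        rw [← hxy, ← hxy, smul_add, smul_smul, smul_smul, div_mul_cancel₀ _ hx]
        congr 2
        field_simp
        linear_combination -h0)
    (fun i => by
      by_contra! h
      exact hc0 i (by rw [← hxy, h.1, h.2]; simp))
    (fun i => (hvef i).symm.imp_left neg_ne_zero.2)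
    (fun i j k l hij hik hil hjk hjl hkl => by
      have hinj := injective_vec_four hij hik hil hjk hjl hkl
      have := hrel (fun r => (![i, j, k, l] r).1) (Subtype.val_injective.comp hinj)
        (fun r => x (![i, j, k, l] r)) (fun r => y (![i, j, k, l] r)) (fun r => (hxy _).symm)
        _ _ (fun r => rfl) (fun r => rfl)
      simp only [cons_val] at this
      linear_combination this)
  let E : ℂ × ℂ → Fin 4 → ℂ := fun z => z.1 • e + z.2 • f
  have hE0 : ∀ z, E z ∈ Submodule.span ℂ {a, b} → z = 0 := fun z hz =>
    Prod.ext (hef _ _ hz).1 (hef _ _ hz).2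
  have hE : ∀ (s t : ℂ) z z', E (s • z + t • z') = s • E z + t • E z' := fun s t z z' => by
    simp only [E, Prod.fst_add, Prod.snd_add, Prod.smul_fst, Prod.smul_snd, smul_eq_mul]
    module
  have hvE : ∀ i z, z.1 * (v i ⬝ᵥ C i *ᵥ e) = z.2 * -(v i ⬝ᵥ C i *ᵥ f) →
      v i ⬝ᵥ C i *ᵥ E z = 0 := fun i z hz => by
    simp only [E, mulVec_add, mulVec_smul, dotProduct_add, dotProduct_smul, smul_eq_mul]
    linear_combination hz
  have hmem : ∀ s t : ℂ, s • a + t • b ∈ Submodule.span ℂ {a, b} := fun s t =>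
    Submodule.mem_span_pair.2 ⟨s, t, rfl⟩
  -- The moving line: `p 0`, `q 0` give the first-order motion, and `p 1`, `q 1` the second-order
  -- one.
  let A : ℂ → Fin 4 → ℂ := fun t => a + t • (E (p 0) + t • E (p 1))
  let B : ℂ → Fin 4 → ℂ := fun t => b + t • (E (q 0) + t • E (q 1))
  have hA : Continuous A := by fun_prop
  have hB : Continuous B := by fun_prop
  refine mem_of_curves A B fun i => ?_
  by_cases hi : c i ∈ Submodule.span ℂ {a, b}
  -- `(x', y')` completes the coordinates of the center to a basis. Replacing `A t`, `B t` by a pair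
  -- starting at the center exposes a factor `t` (or `t * t`), because `C i` kills the center; it is
  -- divided out before taking the limit.
  · obtain ⟨x', y', hd⟩ : ∃ x' y' : ℂ, x ⟨i, hi⟩ * y' - y ⟨i, hi⟩ * x' ≠ 0 := by
      by_cases hx : x ⟨i, hi⟩ = 0
      · refine ⟨1, 0, fun h => hc0 i ?_⟩
        rw [← hxy ⟨i, hi⟩, hx]
        simp only [mul_zero, mul_one, zero_sub, neg_eq_zero] at h
        simp [h]
      · exact ⟨0, 1, by simpa using hx⟩
    set X := x ⟨i, hi⟩
    set Y := y ⟨i, hi⟩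
    have hci : X • a + Y • b = c i := hxy ⟨i, hi⟩
    have hCc : C i *ᵥ c i = 0 := by
      have : c i ∈ center (C i) := by
        rw [hc]
        exact Submodule.mem_span_singleton_self _
      exact this
    let G : ℂ → Fin 4 → ℂ := fun t => x' • A t + y' • B t
    have hG : Continuous G := by fun_prop
    have hG0 : G 0 = x' • a + y' • b := by simp [G, A, B]
    have hvG : v i ⬝ᵥ C i *ᵥ G 0 = 0 := by
      rw [hG0, mulVec_add, mulVec_smul, mulVec_smul, dotProduct_add, dotProduct_smul,
        dotProduct_smul, hva, hvb]
      simp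
    have hcross : ∀ z, z ≠ 0 → crossProduct (C i *ᵥ E z) (C i *ᵥ G 0) ≠ 0 := by
      intro z hz
      refine cross_ne_zero_of_center (hc i) fun s t r hstr => ?_
      have hs : s = 0 := by
        by_contra hs
        refine hz (hE0 z ?_)
        rw [← Submodule.smul_mem_iff _ hs, eq_sub_of_add_eq hstr]
        refine Submodule.sub_mem _ (Submodule.smul_mem _ _ hi) (Submodule.smul_mem _ _ ?_)
        rw [hG0]
        exact hmem _ _
      refine ⟨hs, ?_⟩
      rw [hs, hG0, ← hci] at hstr
      obtain ⟨h1, h2⟩ := hab' (t * x' - r * X) (t * y' - r * Y) (by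
        rw [← sub_eq_zero] at hstr
        rw [← hstr]
        module)
      have : t * (X * y' - Y * x') = 0 := by linear_combination X * h2 - Y * h1
      exact (mul_eq_zero.1 this).resolve_right hd
    have hAB : ∀ t, (X * y' - Y * x') • crossProduct (C i *ᵥ A t) (C i *ᵥ B t) =
        t • crossProduct (C i *ᵥ (E (X • p 0 + Y • q 0) + t • E (X • p 1 + Y • q 1)))
          (C i *ᵥ G t) := by
      intro t
      have hXY : X • A t + Y • B t =
          c i + t • (E (X • p 0 + Y • q 0) + t • E (X • p 1 + Y • q 1)) := by
        rw [← hci, hE, hE]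
        simp only [A, B]
        module
      rw [← cross_combination, hXY, mulVec_add, hCc, zero_add, mulVec_smul, map_smul,
        LinearMap.smul_apply]
    rcases hpq ⟨i, hi⟩ with ⟨h0, h1⟩ | ⟨h0, h1, h2⟩
    · refine ⟨fun t => crossProduct
        (C i *ᵥ (E (X • p 0 + Y • q 0) + t • E (X • p 1 + Y • q 1))) (C i *ᵥ G t),
        continuous_cross (by fun_prop) hG, ?_, fun t ht => ⟨(X * y' - Y * x')⁻¹ * t, ?_, ?_⟩⟩
      · simp only [zero_smul, add_zero]
        exact ⟨hcross _ h0, mk_cross_eq _ (hvE _ _ h1) hvG _⟩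
      · rw [mul_smul, ← hAB, inv_smul_smul₀ hd]
      · exact mul_ne_zero (inv_ne_zero hd) ht
    · have hE00 : E (X • p 0 + Y • q 0) = 0 := by
        rw [h0]
        simp [E]
      refine ⟨fun t => crossProduct (C i *ᵥ E (X • p 1 + Y • q 1)) (C i *ᵥ G t),
        continuous_cross continuous_const hG, ⟨hcross _ h1, mk_cross_eq _ (hvE _ _ h2) hvG _⟩,
        fun t ht => ⟨(X * y' - Y * x')⁻¹ * (t * t), ?_, ?_⟩⟩
      · have := hAB t
        rw [hE00, zero_add, mulVec_smul, map_smul, LinearMap.smul_apply, smul_smul] at this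
        rw [mul_smul, ← this, inv_smul_smul₀ hd]
      · exact mul_ne_zero (inv_ne_zero hd) (mul_ne_zero ht ht)
  · have h0 : crossProduct (C i *ᵥ a) (C i *ᵥ b) ≠ 0 := by
      refine cross_ne_zero_of_center (hc i) fun s t r hstr => hab' s t ?_
      by_cases hr : r = 0
      · rw [hstr, hr, zero_smul]
      · refine absurd ?_ hi
        rw [← Submodule.smul_mem_iff _ hr, ← hstr]
        exact hmem s t
    refine ⟨fun t => crossProduct (C i *ᵥ A t) (C i *ᵥ B t), continuous_cross hA hB, ?_,
      fun t _ => ⟨1, one_smul _ _, one_ne_zero⟩⟩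
    simp only [A, B, zero_smul, add_zero]
    exact ⟨h0, mk_cross_eq _ (hva i) (hvb i) _⟩

/-! ### Linear algebra: a common line and a complement -/

/-- If all maximal minors of triples of rows of a matrix with four columns vanish, then two
linearly independent vectors are in its kernel. -/
theorem exists_pair_of_triples {ι : Type} [Finite ι] (N : ι → Fin 4 → ℂ)
    (h : ∀ k : Fin 3 → ι, Function.Injective k → ∀ u : Fin 3 → Fin 4 → ℂ,
      (Matrix.of fun r s => N (k r) ⬝ᵥ u s).det = 0) :
    ∃ a b : Fin 4 → ℂ, LinearIndependent ℂ ![a, b] ∧ ∀ i, N i ⬝ᵥ a = 0 ∧ N i ⬝ᵥ b = 0 := by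
  have := Fintype.ofFinite ι
  have hrk : (Matrix.of N).rank ≤ 2 := by
    by_contra! h3
    rw [rank_eq_finrank_span_row] at h3
    obtain ⟨f, hf, -, hli⟩ := Submodule.exists_fun_fin_finrank_span_eq ℂ (Set.range (Matrix.of N).row)
    choose k hk using fun r => hf (Fin.castLE h3 r)
    have hli' := hli.comp (Fin.castLE h3) (Fin.castLE_injective h3)
    have hkf : f ∘ Fin.castLE h3 = fun r => N (k r) := funext fun r => (hk r).symm
    rw [hkf] at hli'
    have hsurj : Function.Surjective (Matrix.of fun r => N (k r)).mulVec := by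
      have hr : (Matrix.of fun r => N (k r)).rank = 3 := by
        simpa using LinearIndependent.rank_matrix (M := Matrix.of fun r => N (k r)) hli'
      rw [Matrix.rank] at hr
      exact LinearMap.range_eq_top.1
        (Submodule.eq_top_of_finrank_eq (hr.trans (Module.finrank_fin_fun ℂ).symm))
    -- For three independent rows, the columns of a right inverse are test vectors that make the
    -- determinant 1.
    obtain ⟨U, hU⟩ := mulVec_surjective_iff_exists_right_inverse.1 hsurj
    have hdet := h k (fun r s hrs => hli'.injective (congrArg N hrs)) fun s j => U j s
    have : (Matrix.of fun r s => N (k r) ⬝ᵥ fun j => U j s) = 1 := by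
      rw [← hU]
      rfl
    rw [this, det_one] at hdet
    exact one_ne_zero hdet
  have hker : 2 ≤ Module.finrank ℂ (LinearMap.ker (Matrix.of N).mulVecLin) := by
    have := (Matrix.of N).mulVecLin.finrank_range_add_finrank_ker
    rw [Module.finrank_fin_fun] at this
    rw [Matrix.rank] at hrk
    omega
  obtain ⟨g, hg⟩ := exists_linearIndependent_of_le_finrank hker
  have hz : ∀ j i, N i ⬝ᵥ (g j : Fin 4 → ℂ) = 0 := fun j i => congrFun (g j).2 i
  refine ⟨g 0, g 1, ?_, fun i => ⟨hz 0 i, hz 1 i⟩⟩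
  rw [LinearIndependent.pair_iff]
  intro s t hst
  have h2 := Fintype.linearIndependent_iff.1 hg ![s, t] (by
    ext1
    simpa [Fin.sum_univ_two] using hst)
  exact ⟨h2 0, h2 1⟩

/-- Two linearly independent vectors of `ℂ⁴` extend to a spanning family by two vectors that are
linearly independent modulo their span. -/
theorem exists_complement {a b : Fin 4 → ℂ} (hab : LinearIndependent ℂ ![a, b]) :
    ∃ e f : Fin 4 → ℂ, (∀ s t : ℂ, s • e + t • f ∈ Submodule.span ℂ {a, b} → s = 0 ∧ t = 0) ∧
      ∀ u, ∃ w ∈ Submodule.span ℂ {a, b}, ∃ s t : ℂ, w + (s • e + t • f) = u := by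
  obtain ⟨W, hW⟩ := Submodule.exists_isCompl (Submodule.span ℂ {a, b})
  have hrk := Submodule.finrank_add_eq_of_isCompl hW
  have h2 : Module.finrank ℂ (Submodule.span ℂ (Set.range ![a, b])) = 2 :=
    finrank_span_eq_card hab
  rw [range_cons_cons_empty] at h2
  rw [h2, Module.finrank_fin_fun] at hrk
  let B := Module.finBasisOfFinrankEq ℂ W (n := 2) (by omega)
  refine ⟨B 0, B 1, fun s t hst => ?_, fun u => ?_⟩
  · have h0 : s • (B 0 : Fin 4 → ℂ) + t • (B 1 : Fin 4 → ℂ) = 0 :=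
      Submodule.disjoint_def.1 hW.disjoint _ hst
        (W.add_mem (W.smul_mem _ (B 0).2) (W.smul_mem _ (B 1).2))
    have := Fintype.linearIndependent_iff.1 B.linearIndependent ![s, t] (by
      ext1
      simpa [Fin.sum_univ_two] using h0)
    exact ⟨this 0, this 1⟩
  · have hu : u ∈ Submodule.span ℂ {a, b} ⊔ W := by
      rw [hW.sup_eq_top]
      trivial
    obtain ⟨w, hw, z, hz, rfl⟩ := Submodule.mem_sup.1 hu
    refine ⟨w, hw, B.repr ⟨z, hz⟩ 0, B.repr ⟨z, hz⟩ 1, ?_⟩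
    have := congrArg Subtype.val (B.sum_repr ⟨z, hz⟩)
    rw [Fin.sum_univ_two] at this
    exact congrArg (w + ·) this

theorem exists_dotProduct_mulVec_ne_zero {A : Matrix (Fin 3) (Fin 4) ℂ} (hA : A.rank = 3)
    {v : Fin 3 → ℂ} (hv : v ≠ 0) : ∃ u, v ⬝ᵥ A *ᵥ u ≠ 0 := by
  by_contra! h
  have hsurj : Function.Surjective A.mulVec := by
    rw [Matrix.rank] at hA
    exact LinearMap.range_eq_top.1
      (Submodule.eq_top_of_finrank_eq (hA.trans (Module.finrank_fin_fun ℂ).symm))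
  refine hv (dotProduct_eq_zero v fun w => ?_)
  obtain ⟨u, rfl⟩ := hsurj w
  exact h u

theorem card_image_univ {ι : Type} [DecidableEq ι] {n : ℕ} {k : Fin n → ι}
    (hk : Function.Injective k) : (Finset.univ.image k).card = n := by
  rw [Finset.card_image_of_injective _ hk, Finset.card_univ, Fintype.card_fin]

end LineMultiview


/-! ### The theorem -/

open LineMultiview Matrix in
theorem proposition5p4 (m : ℕ) (hm : 2 ≤ m)
    (C : Fin m → Matrix (Fin 3) (Fin 4) ℂ)
    (hrank : ∀ i, (C i).rank = 3)
    (hcenters : ∀ i j, i ≠ j → LineMultiview.center (C i) ≠ LineMultiview.center (C j)) :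
    LineMultiview.lineMultiviewVariety C =
      ⋂ σ ∈ LineMultiview.tripleAndCollinearQuadruples C,
        LineMultiview.proj σ ⁻¹' LineMultiview.lineMultiviewVariety (LineMultiview.subarrangement C σ) := by
  refine Set.Subset.antisymm
    (Set.subset_iInter₂ fun σ _ => lineMultiviewVariety_subset_preimage C σ) fun ℓ hℓ => ?_
  rw [Set.mem_iInter₂] at hℓ
  have : Nonempty (Fin m) := ⟨⟨0, by omega⟩⟩
  let v : Fin m → Fin 3 → ℂ := fun i => (ℓ i).rep
  have hv : ∀ i, v i ≠ 0 := fun i => (ℓ i).rep_nonzero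
  have hvℓ : (fun i => Projectivization.mk ℂ (v i) (hv i)) = ℓ :=
    funext fun i => (ℓ i).mk_rep
  have hσ : ∀ σ ∈ tripleAndCollinearQuadruples C,
      (fun i : {i // i ∈ σ} => Projectivization.mk ℂ (v i) (hv i)) ∈
        lineMultiviewVariety (subarrangement C σ) := fun σ h => by
    have := hℓ σ h
    rwa [← hvℓ] at this
  choose c hc0 hc using fun i => exists_center_eq_span (hrank i)
  obtain ⟨a, b, hab, hvab⟩ := exists_pair_of_triples (fun i => v i ᵥ* C i) fun k hk u => by
    have := det_plane_eq_zero (C := subarrangement C (Finset.univ.image k))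
      (fun r => ⟨k r, Finset.mem_image_of_mem k (Finset.mem_univ r)⟩) u (fun i => v i)
      (fun i => hv i) (hσ _ (Or.inl (card_image_univ hk)))
    simpa only [subarrangement, dotProduct_mulVec] using this
  simp only [← dotProduct_mulVec] at hvab
  have hvL : ∀ i, ∀ w ∈ Submodule.span ℂ {a, b}, v i ⬝ᵥ C i *ᵥ w = 0 := fun i w hw => by
    obtain ⟨s, t, rfl⟩ := Submodule.mem_span_pair.1 hw
    simp [mulVec_add, mulVec_smul, hvab i]
  obtain ⟨e, f, hef, hspan⟩ := exists_complement hab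
  rw [← hvℓ]
  refine mem_of_common_line c hc0 hc (fun i j hij r hr => ?_) v hv hab (fun i => (hvab i).1)
    (fun i => (hvab i).2) hef (fun i => ?_) fun k hk x y hxy α β hα hβ => ?_
  · have hr0 : r ≠ 0 := by
      rintro rfl
      exact hc0 j (by rw [← hr, zero_smul])
    refine hcenters i j hij ?_
    rw [hc, hc, ← hr, Submodule.span_singleton_smul_eq (IsUnit.mk0 r hr0)]
  -- The equation of the plane is not zero, since `C i` is surjective. It kills `a` and `b`, so it
  -- cannot also kill the complement spanned by `e` and `f`.
  · by_contra! h
    obtain ⟨u, hu⟩ := exists_dotProduct_mulVec_ne_zero (hrank i) (hv i)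
    obtain ⟨w, hw, s, t, rfl⟩ := hspan u
    apply hu
    simp [mulVec_add, mulVec_smul, hvL i w hw, h]
  -- Cross-ratio relations are needed only for centers on the common line; four of these are
  -- collinear, so their index set is one of the given quadruples.
  · have hcol : AreCollinear C (Finset.univ.image k) := by
      refine ⟨Submodule.span ℂ {a, b}, ?_, fun i hi => ?_⟩
      · have h2 := finrank_span_eq_card hab
        rwa [range_cons_cons_empty, Fintype.card_fin] at h2
      · obtain ⟨r, -, rfl⟩ := Finset.mem_image.1 hi
        rw [hc, Submodule.span_singleton_le_iff_mem, hxy]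
        exact Submodule.mem_span_pair.2 ⟨_, _, rfl⟩
    exact cross_ratio_relation (C := subarrangement C (Finset.univ.image k))
      (fun r => ⟨k r, Finset.mem_image_of_mem k (Finset.mem_univ r)⟩) a b x y
      (fun r => by rw [← hxy r]; exact hc (k r)) f e (fun i => v i) (fun i => hv i)
      (hσ _ (Or.inr ⟨card_image_univ hk, hcol⟩)) α β hα hβ
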